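/- Let $R$ be a commutative ring with unity and let $C$ be a semidualizing $R$-module, i.e. an $R$-module such that (1) $C$ has a projective resolution by finitely generated projective modules, (2) the homothety map $R\to\operatorname{Hom}_R(C,C)$ is an isomorphism, and (3) $\operatorname{Ext}^i_R(C,C)=0$ for all $i\ge 1$. An $R$-module $M$ is called $G_C$-projective if there is an exact sequence of $R$-modules $$\mathbb X=\cdots\to P_1\to P_0\to C\otimes_R P_{-1}\to C\otimes_R P_{-2}\to\cdots$$ with all $P_i$ projective, such that $M\cong\operatorname{im}(P_0\to C\otimes_R P_{-1})$ and $\operatorname{Hom}_R(\mathbb X,C\otimes_R P)$ is exact for every projective $R$-module $P$. The ring $R$ is called $G_C$-hereditary if every submodule of a projective $R$-module is $G_C$-projective. If $R$ is $G_C$-hereditary, then $R$ is coherent, i.e. every finitely generated ideal of $R$ is finitely presented. -/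

import Mathlib

open scoped TensorProduct

universe u

/-- `C` admits a degreewise finite projective resolution: an exact sequence
`⋯ → P 1 → P 0 → C → 0` with all `P n` finitely generated projective. -/
def HasDegreewiseFiniteProjectiveResolution (R : Type u) [CommRing R]
    (C : Type u) [AddCommGroup C] [Module R C] : Prop :=
  ∃ (P : ℕ → ModuleCat.{u} R) (d : ∀ n, P (n + 1) →ₗ[R] P n) (ε : P 0 →ₗ[R] C),
    (∀ n, Module.Finite R (P n)) ∧ (∀ n, Module.Projective R (P n)) ∧
    Function.Surjective ε ∧ Function.Exact (d 0) ε ∧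
    ∀ n, Function.Exact (d (n + 1)) (d n)

/-- Semidualizing modules over a commutative ring. -/
structure IsSemidualizing (R : Type u) [CommRing R]
    (C : Type u) [AddCommGroup C] [Module R C] : Prop where
  /-- `C` has a degreewise finite projective resolution. -/
  resolution : HasDegreewiseFiniteProjectiveResolution R C
  /-- The homothety map `R → Hom_R(C, C)`, `r ↦ (c ↦ r • c)`, is an isomorphism. -/
  homothety : Function.Bijective (LinearMap.lsmul R C : R →ₗ[R] C →ₗ[R] C)
  /-- `Ext^i_R(C, C) = 0` for all `i ≥ 1`. -/
  ext_vanishing : ∀ i : ℕ, 1 ≤ i →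
    Subsingleton (CategoryTheory.Abelian.Ext (ModuleCat.of R C) (ModuleCat.of R C) i)

/-- An exact sequence
`⋯ → P 1 → P 0 → C ⊗ Q 0 → C ⊗ Q 1 → ⋯`
with all `P n`, `Q n` projective, which stays exact after applying `Hom_R(-, C ⊗ W)` for every
projective module `W`. (Here `Q n` is the module usually written `P_{-(n+1)}`.) -/
structure CompleteGCResolution (R : Type u) [CommRing R]
    (C : Type u) [AddCommGroup C] [Module R C] where
  /-- The projective modules in the left half. -/
  P : ℕ → ModuleCat.{u} R
  /-- The projective modules that are tensored with `C` in the right half. -/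
  Q : ℕ → ModuleCat.{u} R
  /-- The differentials of the left half. -/
  dP : ∀ n, P (n + 1) →ₗ[R] P n
  /-- The differential joining the two halves. -/
  δ : P 0 →ₗ[R] C ⊗[R] Q 0
  /-- The differentials of the right half. -/
  dQ : ∀ n, C ⊗[R] Q n →ₗ[R] C ⊗[R] Q (n + 1)
  projective_P : ∀ n, Module.Projective R (P n)
  projective_Q : ∀ n, Module.Projective R (Q n)
  exact_P : ∀ n, Function.Exact (dP (n + 1)) (dP n)
  exact_P_δ : Function.Exact (dP 0) δ
  exact_δ_Q : Function.Exact δ (dQ 0)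
  exact_Q : ∀ n, Function.Exact (dQ n) (dQ (n + 1))
  hom_exact_P : ∀ (W : Type u) [AddCommGroup W] [Module R W] [Module.Projective R W] (n : ℕ),
    Function.Exact (fun f : P n →ₗ[R] C ⊗[R] W => f ∘ₗ dP n)
      (fun f : P (n + 1) →ₗ[R] C ⊗[R] W => f ∘ₗ dP (n + 1))
  hom_exact_P_δ : ∀ (W : Type u) [AddCommGroup W] [Module R W] [Module.Projective R W],
    Function.Exact (fun f : C ⊗[R] Q 0 →ₗ[R] C ⊗[R] W => f ∘ₗ δ)
      (fun f : P 0 →ₗ[R] C ⊗[R] W => f ∘ₗ dP 0)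
  hom_exact_δ_Q : ∀ (W : Type u) [AddCommGroup W] [Module R W] [Module.Projective R W],
    Function.Exact (fun f : C ⊗[R] Q 1 →ₗ[R] C ⊗[R] W => f ∘ₗ dQ 0)
      (fun f : C ⊗[R] Q 0 →ₗ[R] C ⊗[R] W => f ∘ₗ δ)
  hom_exact_Q : ∀ (W : Type u) [AddCommGroup W] [Module R W] [Module.Projective R W] (n : ℕ),
    Function.Exact (fun f : C ⊗[R] Q (n + 2) →ₗ[R] C ⊗[R] W => f ∘ₗ dQ (n + 1))
      (fun f : C ⊗[R] Q (n + 1) →ₗ[R] C ⊗[R] W => f ∘ₗ dQ n)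

/-- `M` is `G_C`-projective: it is isomorphic to the image of `P 0 → C ⊗ Q 0` in some
sequence as above. -/
def IsGCProjective (R : Type u) [CommRing R] (C : Type u) [AddCommGroup C] [Module R C]
    (M : Type u) [AddCommGroup M] [Module R M] : Prop :=
  ∃ X : CompleteGCResolution R C, Nonempty (M ≃ₗ[R] LinearMap.range X.δ)

/-- `R` is `G_C`-hereditary: every submodule of a projective module is `G_C`-projective. -/
def IsGCHereditary (R : Type u) [CommRing R] (C : Type u) [AddCommGroup C] [Module R C] : Prop :=
  ∀ (P : Type u) [AddCommGroup P] [Module R P] [Module.Projective R P] (N : Submodule R P),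
    IsGCProjective R C N

/-- A commutative ring is coherent if every finitely generated ideal is finitely presented. -/
def IsCoherentCommRing (R : Type u) [CommRing R] : Prop :=
  ∀ I : Ideal R, I.FG → Module.FinitePresentation R I

/-!
Write `M^∗ = Hom_R(M, C)`. The right half of a complete `G_C`-resolution coresolves a
`G_C`-projective module `M` by summands of direct sums of copies of `C`. When `M` is finitely
generated, so that it only meets finitely many of the copies, the dual of Schanuel's lemma allows
us to replace the terms by finite powers of `C`. Since `(C^n)^∗` is free, dualizing the first steps
shows that `M^∗` is finitely presented and that `M` is `C`-reflexive.

Now let `M` be a finitely generated ideal, and let `0 → M → C^n → N → 0` be its first step. Then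
`N^∗` is finitely generated and lies in the free module `(C^n)^∗`, hence is coresolved in turn, say
by `0 → N^∗ → C^m → L → 0`. Dualizing gives `0 → L^∗ → (C^m)^∗ → N^∗∗ → 0` with `N^∗∗ ≅ N`, where
`L^∗` is finitely presented. Comparing this presentation of `N` with `C^n → N`, we see that `M` is
finitely presented.
-/

/-- `R` is `G_C`-semihereditary: every finitely generated submodule of a projective module is
`G_C`-projective. This is the analogue for finitely generated submodules of `IsGCHereditary`. -/
def IsGCSemihereditary (R : Type u) [CommRing R] (C : Type u) [AddCommGroup C] [Module R C] :
    Prop :=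
  ∀ (P : Type u) [AddCommGroup P] [Module R P] [Module.Projective R P] (N : Submodule R P),
    N.FG → IsGCProjective R C N

section AddClosure

variable {R : Type*} [Ring R] {C : Type u} [AddCommGroup C] [Module R C]

variable (R C) in
/-- The additive closure `Add C`: `D` is a direct summand of a direct sum of copies of `C`. -/
def InAdd (D : Type u) [AddCommGroup D] [Module R D] : Prop :=
  ∃ (ι : Type u) (i : D →ₗ[R] ι →₀ C) (s : (ι →₀ C) →ₗ[R] D), s ∘ₗ i = LinearMap.id

variable {D D' : Type u} [AddCommGroup D] [Module R D] [AddCommGroup D'] [Module R D']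

lemma InAdd.prod (hD : InAdd R C D) (hD' : InAdd R C D') : InAdd R C (D × D') := by
  obtain ⟨ι, i, s, hi⟩ := hD
  obtain ⟨κ, j, t, hj⟩ := hD'
  let e := Finsupp.sumFinsuppLEquivProdFinsupp (α := ι) (β := κ) (M := C) R
  refine ⟨ι ⊕ κ, e.symm.toLinearMap ∘ₗ i.prodMap j, s.prodMap t ∘ₗ e.toLinearMap, ?_⟩
  calc (s.prodMap t ∘ₗ e.toLinearMap) ∘ₗ e.symm.toLinearMap ∘ₗ i.prodMap j
      = s.prodMap t ∘ₗ (e.toLinearMap ∘ₗ e.symm.toLinearMap) ∘ₗ i.prodMap j := rfl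
    _ = (s ∘ₗ i).prodMap (t ∘ₗ j) := by rw [e.comp_symm, LinearMap.id_comp, LinearMap.prodMap_comp]
    _ = LinearMap.id := by rw [hi, hj, LinearMap.prodMap_id]

lemma inAdd_pi (ι : Type u) [Finite ι] : InAdd R C (ι → C) :=
  let e := Finsupp.linearEquivFunOnFinite R C ι
  ⟨ι, e.symm.toLinearMap, e.toLinearMap, e.comp_symm⟩

lemma inAdd_self : InAdd R C C :=
  ⟨PUnit, Finsupp.lsingle PUnit.unit, Finsupp.lapply PUnit.unit, by ext; simp⟩

lemma exists_finset_range_le_supported {M ι : Type*} [AddCommGroup M] [Module R M]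
    [Module.Finite R M] (φ : M →ₗ[R] ι →₀ C) :
    ∃ S : Finset ι, LinearMap.range φ ≤ Finsupp.supported C R S := by
  classical
  obtain ⟨T, hT⟩ := Module.Finite.fg_top (R := R) (M := M)
  refine ⟨T.biUnion fun m => (φ m).support, ?_⟩
  rw [LinearMap.range_eq_map, ← hT, Submodule.map_span_le]
  intro m hm
  rw [Finsupp.mem_supported, Finset.coe_subset]
  exact Finset.subset_biUnion_of_mem (fun m => (φ m).support) hm

lemma exists_factorization_pi {M ι : Type*} [AddCommGroup M] [Module R M] [Module.Finite R M]
    (φ : M →ₗ[R] ι →₀ C) :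
    ∃ (S : Finset ι) (φ' : M →ₗ[R] S → C) (j : (S → C) →ₗ[R] ι →₀ C), j ∘ₗ φ' = φ := by
  obtain ⟨S, hS⟩ := exists_finset_range_le_supported φ
  let e : Finsupp.supported C R (S : Set ι) ≃ₗ[R] (S → C) :=
    Finsupp.supportedEquivFinsupp (S : Set ι) ≪≫ₗ Finsupp.linearEquivFunOnFinite R C S
  refine ⟨S, e.toLinearMap ∘ₗ φ.codRestrict _ fun m => hS ⟨m, rfl⟩,
    Submodule.subtype _ ∘ₗ e.symm.toLinearMap, ?_⟩
  ext1 m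
  simp

end AddClosure

section ProperCosyzygy

variable {R : Type*} [Ring R] {C : Type u} [AddCommGroup C] [Module R C]
variable {M D N D' N' : Type u} [AddCommGroup M] [Module R M] [AddCommGroup D] [Module R D]
  [AddCommGroup N] [Module R N] [AddCommGroup D'] [Module R D'] [AddCommGroup N'] [Module R N']

variable (C) in
/-- `N` is a proper `Add C`-cosyzygy of `M`, as witnessed by a short exact sequence
`0 → M → D → N → 0` with `D` in `Add C` which stays exact under `Hom(-, D')` for all `D'` in
`Add C`. -/
structure IsProperCosyzygy (f : M →ₗ[R] D) (g : D →ₗ[R] N) : Prop where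
  inAdd : InAdd R C D
  injective : Function.Injective f
  exact : Function.Exact f g
  surjective : Function.Surjective g
  exists_extension : ∀ (D' : Type u) [AddCommGroup D'] [Module R D'], InAdd R C D' →
    ∀ φ : M →ₗ[R] D', ∃ ψ : D →ₗ[R] D', ψ ∘ₗ f = φ

namespace IsProperCosyzygy

variable {f : M →ₗ[R] D} {g : D →ₗ[R] N} {f' : M →ₗ[R] D'} {g' : D' →ₗ[R] N'}

lemma comp_equiv {M' : Type u} [AddCommGroup M'] [Module R M'] (h : IsProperCosyzygy C f g)
    (e : M' ≃ₗ[R] M) : IsProperCosyzygy C (f ∘ₗ e.toLinearMap) g where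
  inAdd := h.inAdd
  injective := h.injective.comp e.injective
  exact := e.surjective.comp_exact_iff_exact.mpr h.exact
  surjective := h.surjective
  exists_extension D' _ _ hD' φ := by
    obtain ⟨ψ, hψ⟩ := h.exists_extension D' hD' (φ ∘ₗ e.symm.toLinearMap)
    exact ⟨ψ, by rw [← LinearMap.comp_assoc, hψ, LinearMap.comp_assoc, e.symm_comp]; rfl⟩

lemma prod (h : IsProperCosyzygy C f g) (hD' : InAdd R C D') :
    IsProperCosyzygy C (f.prodMap (LinearMap.id : D' →ₗ[R] D')) (g ∘ₗ LinearMap.fst R D D') where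
  inAdd := h.inAdd.prod hD'
  injective := h.injective.prodMap Function.injective_id
  exact := by
    rintro ⟨x, d⟩
    simpa using h.exact x
  surjective := h.surjective.comp Prod.fst_surjective
  exists_extension E _ _ hE φ := by
    obtain ⟨ψ, hψ⟩ := h.exists_extension E hE (φ ∘ₗ LinearMap.inl R M D')
    refine ⟨ψ.coprod (φ ∘ₗ LinearMap.inr R M D'), LinearMap.ext fun ⟨x, d⟩ => ?_⟩
    calc ψ (f x) + φ (0, d) = φ (x, 0) + φ (0, d) :=
          congrArg (· + φ (0, d)) (LinearMap.congr_fun hψ x)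
      _ = φ (x, d) := by rw [← map_add, Prod.mk_add_mk, add_zero, zero_add]

lemma of_prod {E L : Type u} [AddCommGroup E] [Module R E] [AddCommGroup L] [Module R L]
    {f : M × D →ₗ[R] E} {g : E →ₗ[R] L} {ρ : E →ₗ[R] D} (h : IsProperCosyzygy C f g)
    (hρ : ρ ∘ₗ f = LinearMap.snd R M D) :
    IsProperCosyzygy C (f ∘ₗ LinearMap.inl R M D) (g.prod ρ) where
  inAdd := h.inAdd
  injective := h.injective.comp LinearMap.inl_injective
  exact := by
    have hρ' (x : M × D) : ρ (f x) = x.2 := LinearMap.congr_fun hρ x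
    intro x
    rw [LinearMap.prod_apply, Function.prod_apply, Prod.mk_eq_zero, h.exact x]
    constructor
    · rintro ⟨⟨⟨m, d⟩, rfl⟩, hd⟩
      obtain rfl : d = 0 := by rwa [hρ'] at hd
      exact ⟨m, rfl⟩
    · rintro ⟨m, rfl⟩
      exact ⟨⟨(m, 0), rfl⟩, hρ' (m, 0)⟩
  surjective := by
    rintro ⟨l, d⟩
    obtain ⟨x, rfl⟩ := h.surjective l
    refine ⟨x + f (0, d - ρ x), Prod.ext ?_ ?_⟩
    · simp [h.exact.apply_apply_eq_zero]
    · simp [show ρ (f (0, d - ρ x)) = d - ρ x from LinearMap.congr_fun hρ _]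
  exists_extension D' _ _ hD' φ := by
    obtain ⟨ψ, hψ⟩ := h.exists_extension D' hD' (φ ∘ₗ LinearMap.fst R M D)
    exact ⟨ψ, by rw [← LinearMap.comp_assoc, hψ]; rfl⟩

lemma nonempty_quotient_range_prod_equiv (h : IsProperCosyzygy C f g) (hD' : InAdd R C D')
    (φ : M →ₗ[R] D') : Nonempty (((D × D') ⧸ LinearMap.range (f.prod φ)) ≃ₗ[R] N × D') := by
  obtain ⟨a, rfl⟩ := h.exists_extension D' hD' φ
  let p : D × D' →ₗ[R] N × D' :=
    (g ∘ₗ LinearMap.fst R D D').prod (LinearMap.snd R D D' - a ∘ₗ LinearMap.fst R D D')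
  have hexact : Function.Exact (f.prod (a ∘ₗ f)) p := by
    rintro ⟨d, d'⟩
    calc p (d, d') = 0 ↔ g d = 0 ∧ d' - a d = 0 := Prod.mk_eq_zero
      _ ↔ (∃ m, f m = d) ∧ d' = a d := and_congr (h.exact d) sub_eq_zero
      _ ↔ ∃ m, (f m, a (f m)) = (d, d') := by aesop
  have hp : Function.Surjective p := by
    rintro ⟨n, d'⟩
    obtain ⟨d, rfl⟩ := h.surjective n
    exact ⟨(d, d' + a d), by simp [p]⟩
  exact ⟨hexact.linearEquivOfSurjective hp⟩

/-- The dual of Schanuel's lemma, relative to `Add C`. -/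
lemma nonempty_prod_equiv (h : IsProperCosyzygy C f g) (h' : IsProperCosyzygy C f' g') :
    Nonempty ((N × D') ≃ₗ[R] (N' × D)) := by
  obtain ⟨e⟩ := h.nonempty_quotient_range_prod_equiv h'.inAdd f'
  obtain ⟨e'⟩ := h'.nonempty_quotient_range_prod_equiv h.inAdd f
  let swap := Submodule.Quotient.equiv (LinearMap.range (f.prod f')) (LinearMap.range (f'.prod f))
    (LinearEquiv.prodComm R D D') (LinearMap.range_comp _ _).symm
  exact ⟨e.symm ≪≫ₗ swap ≪≫ₗ e'⟩

lemma mkQ_of_comp_eq (h : IsProperCosyzygy C f g) (hD' : InAdd R C D') {t : D' →ₗ[R] D}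
    (ht : t ∘ₗ f' = f) : IsProperCosyzygy C f' (LinearMap.range f').mkQ where
  inAdd := hD'
  injective := .of_comp (f := t) (by rw [← LinearMap.coe_comp, ht]; exact h.injective)
  exact := LinearMap.exact_map_mkQ_range _
  surjective := Submodule.mkQ_surjective _
  exists_extension E _ _ hE φ := by
    obtain ⟨ψ, hψ⟩ := h.exists_extension E hE φ
    exact ⟨ψ ∘ₗ t, by rw [LinearMap.comp_assoc, ht, hψ]⟩

lemma exists_pi [Module.Finite R M] (h : IsProperCosyzygy C f g) :
    ∃ (ι : Type u) (_ : Finite ι) (φ : M →ₗ[R] ι → C),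
      IsProperCosyzygy C φ (LinearMap.range φ).mkQ := by
  obtain ⟨ι, i, s, hsi⟩ := h.inAdd
  obtain ⟨S, φ, j, hφ⟩ := exists_factorization_pi (i ∘ₗ f)
  refine ⟨S, inferInstance, φ, h.mkQ_of_comp_eq (inAdd_pi S) (t := s ∘ₗ j) ?_⟩
  rw [LinearMap.comp_assoc, hφ, ← LinearMap.comp_assoc, hsi, LinearMap.id_comp]

end IsProperCosyzygy

variable (R C) in
/-- `M` has the first `k` steps `0 → M → D₁ → ⋯ → D_k` of a coresolution by modules in `Add C` that
stays exact under `Hom(-, D')` for all `D'` in `Add C`; it is encoded by iterated cosyzygies. -/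
def HasProperCoresolution : ℕ → ∀ (M : Type u) [AddCommGroup M] [Module R M], Prop
  | 0, _, _, _ => True
  | k + 1, M, _, _ => ∃ (D N : ModuleCat.{u} R) (f : M →ₗ[R] D) (g : D →ₗ[R] N),
      IsProperCosyzygy C f g ∧ HasProperCoresolution k N

namespace HasProperCoresolution

variable {k : ℕ}

lemma of_equiv (e : M ≃ₗ[R] N) (h : HasProperCoresolution R C k M) :
    HasProperCoresolution R C k N := by
  cases k with
  | zero => trivial
  | succ k =>
    obtain ⟨D, L, f, g, hfg, hL⟩ := h
    exact ⟨D, L, _, g, hfg.comp_equiv e.symm, hL⟩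

lemma prod (h : HasProperCoresolution R C k M) (hD : InAdd R C D) :
    HasProperCoresolution R C k (M × D) := by
  cases k with
  | zero => trivial
  | succ k =>
    obtain ⟨E, L, f, g, hfg, hL⟩ := h
    exact ⟨ModuleCat.of R (E × D), L, _, _, hfg.prod hD, hL⟩

lemma of_prod (h : HasProperCoresolution R C k (M × D)) (hD : InAdd R C D) :
    HasProperCoresolution R C k M := by
  cases k with
  | zero => trivial
  | succ k =>
    obtain ⟨E, L, f, g, hfg, hL⟩ := h
    obtain ⟨ρ, hρ⟩ := hfg.exists_extension D hD (LinearMap.snd R M D)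
    exact ⟨E, ModuleCat.of R (L × D), _, _, hfg.of_prod hρ, hL.prod hD⟩

lemma exists_pi [Module.Finite R M] (h : HasProperCoresolution R C (k + 1) M) :
    ∃ (ι : Type u) (_ : Finite ι) (N : ModuleCat.{u} R) (f : M →ₗ[R] ι → C)
      (g : (ι → C) →ₗ[R] N), IsProperCosyzygy C f g ∧ HasProperCoresolution R C k N := by
  obtain ⟨D, L, f, g, hfg, hL⟩ := h
  obtain ⟨ι, _, φ, hφ⟩ := hfg.exists_pi
  obtain ⟨e⟩ := hfg.nonempty_prod_equiv hφ
  exact ⟨ι, inferInstance, ModuleCat.of R ((ι → C) ⧸ LinearMap.range φ), φ, _, hφ,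
    ((hL.prod (inAdd_pi ι)).of_equiv e).of_prod hfg.inAdd⟩

end HasProperCoresolution

end ProperCosyzygy

section CompleteResolution

variable {R : Type u} [CommRing R] {C : Type u} [AddCommGroup C] [Module R C]

lemma inAdd_tensorProduct (Q : Type u) [AddCommGroup Q] [Module R Q] [Module.Projective R Q] :
    InAdd R C (C ⊗[R] Q) := by
  classical
  obtain ⟨s, hs⟩ := Module.projective_def'.mp (inferInstance : Module.Projective R Q)
  let e := TensorProduct.finsuppScalarRight R R C Q
  refine ⟨Q, e.toLinearMap ∘ₗ s.lTensor C,
    (Finsupp.linearCombination R id).lTensor C ∘ₗ e.symm.toLinearMap, ?_⟩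
  rw [LinearMap.comp_assoc, ← LinearMap.comp_assoc _ e.toLinearMap, e.symm_comp,
    LinearMap.id_comp, ← LinearMap.lTensor_comp, hs, LinearMap.lTensor_id]

lemma InAdd.exists_retract_tensorProduct {D : Type u} [AddCommGroup D] [Module R D]
    (hD : InAdd R C D) :
    ∃ (ι : Type u) (i : D →ₗ[R] C ⊗[R] (ι →₀ R)) (s : C ⊗[R] (ι →₀ R) →ₗ[R] D),
      s ∘ₗ i = LinearMap.id := by
  classical
  obtain ⟨ι, i, s, hsi⟩ := hD
  let e := TensorProduct.finsuppScalarRight R R C ι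
  refine ⟨ι, e.symm.toLinearMap ∘ₗ i, s ∘ₗ e.toLinearMap, ?_⟩
  rw [LinearMap.comp_assoc, ← LinearMap.comp_assoc _ e.symm.toLinearMap, e.comp_symm,
    LinearMap.id_comp, hsi]

lemma isProperCosyzygy_range {A B Q E : Type u} [AddCommGroup A] [Module R A] [AddCommGroup B]
    [Module R B] [AddCommGroup Q] [Module R Q] [Module.Projective R Q] [AddCommGroup E]
    [Module R E] {a : A →ₗ[R] B} {b : B →ₗ[R] C ⊗[R] Q} {c : C ⊗[R] Q →ₗ[R] E}
    (hab : b ∘ₗ a = 0) (hbc : Function.Exact b c)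
    (hom_exact : ∀ (W : Type u) [AddCommGroup W] [Module R W] [Module.Projective R W],
      Function.Exact (fun f : C ⊗[R] Q →ₗ[R] C ⊗[R] W => f ∘ₗ b)
        (fun f : B →ₗ[R] C ⊗[R] W => f ∘ₗ a)) :
    IsProperCosyzygy C (LinearMap.range b).subtype c.rangeRestrict where
  inAdd := inAdd_tensorProduct Q
  injective := Subtype.val_injective
  exact x := by
    rw [← LinearMap.mem_ker, LinearMap.ker_rangeRestrict, LinearMap.mem_ker, hbc x]
    simp
  surjective := c.surjective_rangeRestrict
  exists_extension D' _ _ hD' φ := by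
    obtain ⟨ι, i, s, hsi⟩ := hD'.exists_retract_tensorProduct
    have hba : b.rangeRestrict ∘ₗ a = 0 :=
      LinearMap.ext fun x => Subtype.ext (LinearMap.congr_fun hab x)
    obtain ⟨ψ, hψ⟩ := (hom_exact (ι →₀ R) (i ∘ₗ φ ∘ₗ b.rangeRestrict)).mp <| by
      simp only [LinearMap.comp_assoc, hba, LinearMap.comp_zero]
    refine ⟨s ∘ₗ ψ, LinearMap.cancel_right b.surjective_rangeRestrict |>.mp ?_⟩
    calc (s ∘ₗ ψ) ∘ₗ b = s ∘ₗ i ∘ₗ φ ∘ₗ b.rangeRestrict := congrArg (s ∘ₗ ·) hψ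
      _ = φ ∘ₗ b.rangeRestrict := by rw [← LinearMap.comp_assoc, hsi, LinearMap.id_comp]

lemma hasProperCoresolution_range_dQ (X : CompleteGCResolution R C) (k n : ℕ) :
    HasProperCoresolution R C k (LinearMap.range (X.dQ n)) := by
  induction k generalizing n with
  | zero => trivial
  | succ k ih =>
    have := X.projective_Q
    refine ⟨ModuleCat.of R (C ⊗[R] X.Q (n + 1)), ModuleCat.of R (LinearMap.range (X.dQ (n + 1))),
      (LinearMap.range (X.dQ n)).subtype, (X.dQ (n + 1)).rangeRestrict, ?_, ih (n + 1)⟩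
    cases n with
    | zero =>
      exact isProperCosyzygy_range X.exact_δ_Q.linearMap_comp_eq_zero (X.exact_Q 0) X.hom_exact_δ_Q
    | succ n =>
      exact isProperCosyzygy_range (X.exact_Q n).linearMap_comp_eq_zero (X.exact_Q (n + 1))
        fun W => X.hom_exact_Q W n

lemma IsGCProjective.hasProperCoresolution {M : Type u} [AddCommGroup M] [Module R M]
    (h : IsGCProjective R C M) (k : ℕ) : HasProperCoresolution R C k M := by
  obtain ⟨X, ⟨e⟩⟩ := h
  refine HasProperCoresolution.of_equiv e.symm ?_
  cases k with
  | zero => trivial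
  | succ k =>
    have := X.projective_Q
    exact ⟨ModuleCat.of R (C ⊗[R] X.Q 0), ModuleCat.of R (LinearMap.range (X.dQ 0)), _, _,
      isProperCosyzygy_range X.exact_P_δ.linearMap_comp_eq_zero X.exact_δ_Q X.hom_exact_P_δ,
      hasProperCoresolution_range_dQ X k 0⟩

end CompleteResolution

section Duality

variable {R : Type u} [CommRing R] {C : Type u} [AddCommGroup C] [Module R C]
variable {M N D : Type u} [AddCommGroup M] [Module R M] [AddCommGroup N] [Module R N]
  [AddCommGroup D] [Module R D]

lemma IsProperCosyzygy.lcomp_surjective {f : M →ₗ[R] D} {g : D →ₗ[R] N}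
    (h : IsProperCosyzygy C f g) : Function.Surjective (LinearMap.lcomp R C f) :=
  h.exists_extension C inAdd_self

lemma IsProperCosyzygy.exact_lcomp {f : M →ₗ[R] D} {g : D →ₗ[R] N}
    (h : IsProperCosyzygy C f g) :
    Function.Exact (LinearMap.lcomp R C g) (LinearMap.lcomp R C f) :=
  LinearMap.exact_lcomp_of_exact_of_surjective C h.exact h.surjective

lemma nonempty_pi_equiv_hom_pi
    (hC : Function.Bijective (LinearMap.lsmul R C : R →ₗ[R] C →ₗ[R] C)) (ι : Type*) [Finite ι] :
    Nonempty ((ι → R) ≃ₗ[R] ((ι → C) →ₗ[R] C)) := by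
  classical
  have := Fintype.ofFinite ι
  exact ⟨(LinearEquiv.piCongrRight fun _ => LinearEquiv.ofBijective _ hC) ≪≫ₗ
    LinearMap.lsum R (fun _ : ι => C) R⟩

lemma free_hom_pi (hC : Function.Bijective (LinearMap.lsmul R C : R →ₗ[R] C →ₗ[R] C))
    (ι : Type*) [Finite ι] : Module.Free R ((ι → C) →ₗ[R] C) :=
  let ⟨e⟩ := nonempty_pi_equiv_hom_pi hC ι
  .of_equiv e

lemma finite_hom_pi (hC : Function.Bijective (LinearMap.lsmul R C : R →ₗ[R] C →ₗ[R] C))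
    (ι : Type*) [Finite ι] : Module.Finite R ((ι → C) →ₗ[R] C) :=
  let ⟨e⟩ := nonempty_pi_equiv_hom_pi hC ι
  .equiv e

lemma applyₗ_pi_surjective
    (hC : Function.Surjective (LinearMap.lsmul R C : R →ₗ[R] C →ₗ[R] C)) (ι : Type*) [Finite ι] :
    Function.Surjective (LinearMap.applyₗ : (ι → C) →ₗ[R] ((ι → C) →ₗ[R] C) →ₗ[R] C) := by
  classical
  have := Fintype.ofFinite ι
  intro φ
  refine ⟨fun i => φ (LinearMap.proj i), LinearMap.ext fun ψ => ?_⟩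
  choose r hr using fun i => hC (ψ ∘ₗ LinearMap.single R (fun _ : ι => C) i)
  have hψ : ψ = ∑ i, r i • (LinearMap.proj i : (ι → C) →ₗ[R] C) := by
    refine LinearMap.pi_ext' fun i => LinearMap.ext fun c => ?_
    rw [← hr i]
    simp [Pi.single_apply]
  simp [hψ]

lemma applyₗ_injective_of_injective_pi {ι : Type*} {f : M →ₗ[R] ι → C}
    (hf : Function.Injective f) :
    Function.Injective (LinearMap.applyₗ : M →ₗ[R] (M →ₗ[R] C) →ₗ[R] C) := by
  intro x y hxy
  exact hf (funext fun i => LinearMap.congr_fun hxy ((LinearMap.proj i : (ι → C) →ₗ[R] C) ∘ₗ f))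

lemma applyₗ_surjective_of_isProperCosyzygy
    (hC : Function.Surjective (LinearMap.lsmul R C : R →ₗ[R] C →ₗ[R] C)) {ι : Type u} [Finite ι]
    {f : M →ₗ[R] ι → C} {g : (ι → C) →ₗ[R] N} (hfg : IsProperCosyzygy C f g)
    (hN : Function.Injective (LinearMap.applyₗ : N →ₗ[R] (N →ₗ[R] C) →ₗ[R] C)) :
    Function.Surjective (LinearMap.applyₗ : M →ₗ[R] (M →ₗ[R] C) →ₗ[R] C) := by
  intro φ
  obtain ⟨d, hd⟩ := applyₗ_pi_surjective hC ι (φ ∘ₗ LinearMap.lcomp R C f)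
  replace hd (ψ : (ι → C) →ₗ[R] C) : ψ d = φ (ψ ∘ₗ f) := LinearMap.congr_fun hd ψ
  have hgd : g d = 0 := by
    refine (injective_iff_map_eq_zero _).mp hN _ (LinearMap.ext fun χ => ?_)
    calc χ (g d) = φ ((χ ∘ₗ g) ∘ₗ f) := hd (χ ∘ₗ g)
      _ = 0 := by
        rw [LinearMap.comp_assoc, hfg.exact.linearMap_comp_eq_zero, LinearMap.comp_zero, map_zero]
  obtain ⟨m, rfl⟩ := (hfg.exact d).mp hgd
  refine ⟨m, LinearMap.ext fun ψ => ?_⟩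
  obtain ⟨ψ', rfl⟩ := hfg.lcomp_surjective ψ
  exact hd ψ'

namespace HasProperCoresolution

variable {k : ℕ} [Module.Finite R M]

lemma finite_hom (hC : Function.Bijective (LinearMap.lsmul R C : R →ₗ[R] C →ₗ[R] C))
    (h : HasProperCoresolution R C (k + 1) M) : Module.Finite R (M →ₗ[R] C) := by
  obtain ⟨ι, _, N, f, g, hfg, -⟩ := h.exists_pi
  have := finite_hom_pi hC ι
  exact Module.Finite.of_surjective _ hfg.lcomp_surjective

variable [Module.Finite R C]

lemma finitePresentation_hom
    (hC : Function.Bijective (LinearMap.lsmul R C : R →ₗ[R] C →ₗ[R] C))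
    (h : HasProperCoresolution R C (k + 2) M) : Module.FinitePresentation R (M →ₗ[R] C) := by
  obtain ⟨ι, _, N, f, g, hfg, hN⟩ := h.exists_pi
  have := Module.Finite.of_surjective g hfg.surjective
  have := hN.finite_hom hC
  have := free_hom_pi hC ι
  have := finite_hom_pi hC ι
  have := Module.finitePresentation_of_projective R ((ι → C) →ₗ[R] C)
  refine Module.finitePresentation_of_surjective _ hfg.lcomp_surjective ?_
  rw [hfg.exact_lcomp.linearMap_ker_eq]
  exact Submodule.fg_range _

lemma exists_projective_presentation_hom
    (hC : Function.Bijective (LinearMap.lsmul R C : R →ₗ[R] C →ₗ[R] C))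
    (h : HasProperCoresolution R C (k + 3) M) :
    ∃ (F : ModuleCat.{u} R) (π : F →ₗ[R] M →ₗ[R] C), Module.Projective R F ∧
      Function.Surjective π ∧ Module.FinitePresentation R (LinearMap.ker π) := by
  obtain ⟨ι, _, N, f, g, hfg, hN⟩ := h.exists_pi
  have := Module.Finite.of_surjective g hfg.surjective
  have := hN.finitePresentation_hom hC
  have := free_hom_pi hC ι
  let e : (N →ₗ[R] C) ≃ₗ[R] LinearMap.ker (LinearMap.lcomp R C f) :=
    LinearEquiv.ofInjective _ (LinearMap.lcomp_injective_of_surjective g hfg.surjective) ≪≫ₗ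
      LinearEquiv.ofEq _ _ hfg.exact_lcomp.linearMap_ker_eq.symm
  exact ⟨ModuleCat.of R ((ι → C) →ₗ[R] C), LinearMap.lcomp R C f,
    inferInstanceAs (Module.Projective R ((ι → C) →ₗ[R] C)), hfg.lcomp_surjective, .of_equiv e⟩

lemma applyₗ_bijective (hC : Function.Surjective (LinearMap.lsmul R C : R →ₗ[R] C →ₗ[R] C))
    (h : HasProperCoresolution R C (k + 2) M) :
    Function.Bijective (LinearMap.applyₗ : M →ₗ[R] (M →ₗ[R] C) →ₗ[R] C) := by
  obtain ⟨ι, _, N, f, g, hfg, hN⟩ := h.exists_pi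
  have := Module.Finite.of_surjective g hfg.surjective
  obtain ⟨κ, _, _, f', _, hfg', -⟩ := hN.exists_pi
  exact ⟨applyₗ_injective_of_injective_pi hfg.injective,
    applyₗ_surjective_of_isProperCosyzygy hC hfg (applyₗ_injective_of_injective_pi hfg'.injective)⟩

end HasProperCoresolution

end Duality

section FinitePresentation

variable {R : Type*} [Ring R] {M D N F : Type*} [AddCommGroup M] [Module R M] [AddCommGroup D]
  [Module R D] [AddCommGroup N] [Module R N] [AddCommGroup F] [Module R F]

lemma nonempty_ker_coprod_equiv_ker_comp {f : M →ₗ[R] D} {g : D →ₗ[R] N}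
    (hf : Function.Injective f) (hfg : Function.Exact f g) (l : F →ₗ[R] D) :
    Nonempty (LinearMap.ker (f.coprod l) ≃ₗ[R] LinearMap.ker (g ∘ₗ l)) := by
  have hgl (y : M × F) : (g ∘ₗ l) y.2 = g (f.coprod l y) := by simp [hfg.apply_apply_eq_zero]
  let q : LinearMap.ker (f.coprod l) →ₗ[R] LinearMap.ker (g ∘ₗ l) :=
    (LinearMap.snd R M F).restrict fun y hy => by
      rw [LinearMap.mem_ker] at hy ⊢
      rw [LinearMap.snd_apply, hgl, hy, map_zero]
  refine ⟨LinearEquiv.ofBijective q ⟨(injective_iff_map_eq_zero q).mpr ?_, ?_⟩⟩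
  · rintro ⟨⟨m, x⟩, hy⟩ hx
    obtain rfl : x = 0 := congrArg Subtype.val hx
    have hm : f m = 0 := by simpa using hy
    obtain rfl : m = 0 := (map_eq_zero_iff f hf).mp hm
    rfl
  · rintro ⟨x, hx⟩
    obtain ⟨m, hm⟩ := (hfg (l x)).mp hx
    exact ⟨⟨(-m, x), by simp [hm]⟩, rfl⟩

lemma finitePresentation_of_exact_of_projective_presentation [Module.FinitePresentation R D]
    [Module.Projective R F] {f : M →ₗ[R] D} {g : D →ₗ[R] N} (hf : Function.Injective f)
    (hfg : Function.Exact f g) (hg : Function.Surjective g) {π : F →ₗ[R] N}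
    (hπ : Function.Surjective π) [Module.FinitePresentation R (LinearMap.ker π)] :
    Module.FinitePresentation R M := by
  -- As in Schanuel's lemma, a lift `l : F → D` of `π` gives `0 → ker π → M × F → D → 0`.
  obtain ⟨l, rfl⟩ := Module.projective_lifting_property g π hg
  have hsurj : Function.Surjective (f.coprod l) := fun d => by
    obtain ⟨x, hx⟩ := hπ (g d)
    obtain ⟨m, hm⟩ := (hfg (d - l x)).mp (by rw [map_sub, ← hx, LinearMap.comp_apply, sub_self])
    exact ⟨(m, x), by simp [hm]⟩
  obtain ⟨e⟩ := nonempty_ker_coprod_equiv_ker_comp hf hfg l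
  have : Module.FinitePresentation R (LinearMap.ker (f.coprod l)) := .of_equiv e.symm
  have : Module.FinitePresentation R (M × F) := Module.finitePresentation_of_ker _ hsurj
  exact Module.finitePresentation_of_projective_of_exact (LinearMap.inl R M F)
    (LinearMap.snd R M F) LinearMap.inl_injective LinearMap.snd_surjective Function.Exact.inl_snd

lemma HasDegreewiseFiniteProjectiveResolution.finitePresentation {R : Type u} [CommRing R]
    {C : Type u} [AddCommGroup C] [Module R C]
    (h : HasDegreewiseFiniteProjectiveResolution R C) : Module.FinitePresentation R C := by
  obtain ⟨P, d, ε, _, _, hε, hexact, -⟩ := h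
  have := Module.finitePresentation_of_projective R (P 0)
  refine Module.finitePresentation_of_surjective ε hε ?_
  rw [hexact.linearMap_ker_eq]
  exact Submodule.fg_range _

end FinitePresentation

section Semihereditary

variable {R : Type u} [CommRing R] {C : Type u} [AddCommGroup C] [Module R C]

lemma IsGCHereditary.isGCSemihereditary (hR : IsGCHereditary R C) : IsGCSemihereditary R C :=
  fun P _ _ _ N _ => hR P N

namespace IsGCSemihereditary

variable {M P : Type u} [AddCommGroup M] [Module R M] [Module.Finite R M] [AddCommGroup P]
  [Module R P] [Module.Projective R P]

lemma hasProperCoresolution (hR : IsGCSemihereditary R C) {i : M →ₗ[R] P}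
    (hi : Function.Injective i) (k : ℕ) : HasProperCoresolution R C k M :=
  ((hR P (LinearMap.range i) (Submodule.fg_range i)).hasProperCoresolution k).of_equiv
    (LinearEquiv.ofInjective i hi).symm

lemma finitePresentation [Module.FinitePresentation R C]
    (hC : Function.Bijective (LinearMap.lsmul R C : R →ₗ[R] C →ₗ[R] C))
    (hR : IsGCSemihereditary R C) {i : M →ₗ[R] P} (hi : Function.Injective i) :
    Module.FinitePresentation R M := by
  obtain ⟨ι, _, N, f, g, hfg, hN⟩ := (hR.hasProperCoresolution hi 3).exists_pi
  have := Module.Finite.of_surjective g hfg.surjective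
  have : Module.Finite R (N →ₗ[R] C) := hN.finite_hom hC
  have := free_hom_pi hC ι
  have hN_dual : HasProperCoresolution R C 3 (N →ₗ[R] C) :=
    hR.hasProperCoresolution (LinearMap.lcomp_injective_of_surjective g hfg.surjective) 3
  obtain ⟨F, π, _, hπ, _⟩ := hN_dual.exists_projective_presentation_hom hC
  let biduality := LinearEquiv.ofBijective _ (hN.applyₗ_bijective hC.surjective)
  let π' : F →ₗ[R] N := biduality.symm.toLinearMap ∘ₗ π
  have hker : LinearMap.ker π' = LinearMap.ker π := LinearEquiv.ker_comp _ _
  have : Module.FinitePresentation R (LinearMap.ker π') := by rwa [hker]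
  exact finitePresentation_of_exact_of_projective_presentation hfg.injective hfg.exact
    hfg.surjective (π := π') (biduality.symm.surjective.comp hπ)

end IsGCSemihereditary

end Semihereditary

theorem corollary3p4_general {R : Type u} [CommRing R] (C : Type u) [AddCommGroup C] [Module R C]
    [Module.FinitePresentation R C]
    (hC : Function.Bijective (LinearMap.lsmul R C : R →ₗ[R] C →ₗ[R] C))
    (hR : IsGCSemihereditary R C) : IsCoherentCommRing R := fun I hI =>
  have : Module.Finite R I := Module.Finite.iff_fg.mpr hI
  hR.finitePresentation hC I.subtype_injective

theorem corollary3p4 {R : Type u} [CommRing R] (C : Type u) [AddCommGroup C] [Module R C]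
    (hC : IsSemidualizing R C) (hR : IsGCHereditary R C) : IsCoherentCommRing R :=
  have := hC.resolution.finitePresentation
  corollary3p4_general C hC.homothety hR.isGCSemihereditary
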